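/- Let $N\ge 1$ and, for $n=1,\dots,N$, let $M_n\ge 2$ be an integer, $r_n>0$, $\theta_n\in\mathbb{R}$, and $w_n>0$ with $\sum_n w_n=1$. Let $\mathcal{X}_n=\{r_n e^{i(\theta_n+2\pi k/M_n)}: 0\le k<M_n\}$ be the $M_n$-PSK ring of radius $r_n$ and phase offset $\theta_n$, where all rings with $M_n=2$ lie on a common line through the origin, i.e. $\theta_i-\theta_j\in\pi\mathbb{Z}$ whenever $M_i=M_j=2$ (for instance, all $\theta_n=0$); the other offsets are arbitrary. Let $X$ be the mixture of the uniform distributions on the rings with weights $w_n$ (that is, $P_X(x)=\sum_n w_n\mathbf{1}_{x\in\mathcal{X}_n}/M_n$ on $\mathcal{X}=\bigcup_n\mathcal{X}_n$), and assume unit average energy $\mathbb{E}|X|^2=1$. Let $$C(\mathrm{SNR})=-\mathbb{E}\Bigl[\log\sum_{x'\in\mathcal{X}}P_X(x')\,e^{-|\sqrt{\mathrm{SNR}}\,(X-x')+Z|^2+|Z|^2}\Bigr]$$ be the mutual information in nats between input and output of the channel $Y=\sqrt{\mathrm{SNR}}\,X+Z$, where $Z$ is circularly symmetric complex Gaussian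 noise with $\mathbb{E}|Z|^2=1$, independent of $X$. Then $C$ admits an expansion $C(\mathrm{SNR})=c_1\,\mathrm{SNR}+c_2\,\mathrm{SNR}^2+o(\mathrm{SNR}^2)$ as $\mathrm{SNR}\to0^+$, and its coefficient $c_2$ equals $-\tfrac12$ if and only if $M_n>2$ for all $n=1,\dots,N$. -/

import Mathlib

open Filter Topology Asymptotics MeasureTheory

/-- Law of circularly symmetric complex Gaussian noise of unit variance:
density `(1/π) exp(-|z|²)` with respect to Lebesgue measure on `ℂ`. -/
noncomputable def complexNoise : Measure ℂ :=
  (volume : Measure ℂ).withDensity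
    (fun z => ENNReal.ofReal (1 / Real.pi * Real.exp (-‖z‖ ^ 2)))

/-- Constrained (coded modulation) capacity, in nats, of the channel `Y = √snr X + Z`,
where `X` takes values in the finite set `S` with probabilities `P` and `Z` is independent
unit-variance complex Gaussian noise:
`-E[log (∑ x' ∈ S, P x' exp(-|√snr (X - x') + Z|² + |Z|²))]`. -/
noncomputable def constrainedCapacity (S : Finset ℂ) (P : ℂ → ℝ) (snr : ℝ) : ℝ :=
  -∑ x ∈ S, P x * ∫ z, Real.log (∑ x' ∈ S, P x' *
      Real.exp (-‖(Real.sqrt snr : ℂ) * (x - x') + z‖ ^ 2 + ‖z‖ ^ 2)) ∂complexNoise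

/-- `C(snr) = c₁ snr + c₂ snr² + o(snr²)` as `snr → 0⁺`. -/
def HasLowSNRExpansion (C : ℝ → ℝ) (c₁ c₂ : ℝ) : Prop :=
  (fun snr : ℝ => C snr - (c₁ * snr + c₂ * snr ^ 2)) =o[𝓝[>] 0] (fun snr : ℝ => snr ^ 2)

/-- Second moment (average energy) `μ₂ = ∑ x ∈ S, |x|² P x`. -/
noncomputable def secondMoment (S : Finset ℂ) (P : ℂ → ℝ) : ℝ :=
  ∑ x ∈ S, ‖x‖ ^ 2 * P x

/-- The `M`-PSK constellation of radius `r` and phase offset `θ`: the points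
`r exp(i (θ + 2πk/M))`, `k = 0, …, M - 1`. -/
noncomputable def pskRing (M : ℕ) (r θ : ℝ) : Finset ℂ :=
  (Finset.range M).image fun k : ℕ =>
    (r : ℂ) * Complex.exp (((θ + 2 * Real.pi * k / M : ℝ) : ℂ) * Complex.I)

/-- The probabilities of equiprobable signalling over the finite set `S`. -/
noncomputable def uniformProb (S : Finset ℂ) (x : ℂ) : ℝ :=
  if x ∈ S then 1 / (S.card : ℝ) else 0

/-- The signal set of a mixture of constellations: the union of the signal sets. -/
noncomputable def mixtureSet {N : ℕ} (A : Fin N → Finset ℂ) : Finset ℂ :=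
  Finset.univ.biUnion A

/-- The probabilities of the mixture that uses constellation `A n`, with equiprobable symbols,
with probability `w n`. -/
noncomputable def mixtureProb {N : ℕ} (w : Fin N → ℝ) (A : Fin N → Finset ℂ) (x : ℂ) : ℝ :=
  ∑ n, w n * uniformProb (A n) x

/-! ### Integration against the complex Gaussian noise -/

/-! Put `s = √snr`. Relative to the noise law, the law of `sX + Z` has density `L(y) = E exp(2s⟨X,y⟩
- s²|X|²)`, where `⟨x,y⟩` is the real inner product on `ℂ`. The capacity equals `s² E|X|²` minus the
relative entropy `∫ (L log L - (L - 1))` (`constrainedCapacity_sq`). When `E X = 0`, the first-order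
term of `L` vanishes and `L = 1 + s² q + o(s²)` pointwise, with `q(y) = 2 E⟨X,y⟩² - E|X|²`. Since `x
log x - (x - 1)` behaves like `(x - 1)²/2` near `1`, dominated convergence shows that the relative
entropy is `s⁴ ∫ q²/2 + o(s⁴)`. Gaussian moments give `∫ q² = (E|X|²)² + |E X²|²`
(`integral_second_order_sq`), so at unit energy `c₂ = -(1 + |E X²|²)/2`, and `c₂ = -1/2` exactly
when `E X² = 0`.

On an `M`-PSK ring the sum of `x^j` is a geometric sum that vanishes for `0 < j < M`. Hence the mean
is always zero, and only rings with `M = 2` contribute to `E X²`. Their contributions `w r²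
exp(2iθ)` share one phase by collinearity, so they cannot cancel. -/

theorem integral_complexNoise (f : ℂ → ℝ) :
    ∫ z, f z ∂complexNoise = ∫ z : ℂ, 1 / Real.pi * Real.exp (-‖z‖ ^ 2) * f z := by
  unfold complexNoise
  rw [integral_withDensity_eq_integral_toReal_smul (by fun_prop) (by simp)]
  refine integral_congr_ae (Eventually.of_forall fun z => ?_)
  simp only [smul_eq_mul]
  rw [ENNReal.toReal_ofReal (by positivity)]

theorem integrable_complexNoise_iff (f : ℂ → ℝ) :
    Integrable f complexNoise ↔
      Integrable (fun z : ℂ => f z * (1 / Real.pi * Real.exp (-‖z‖ ^ 2))) := by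
  unfold complexNoise
  rw [integrable_withDensity_iff (by fun_prop) (by simp)]
  refine integrable_congr (Eventually.of_forall fun z => ?_)
  simp only
  rw [ENNReal.toReal_ofReal (by positivity)]

theorem integrable_exp_neg_mul_norm_sq {b : ℝ} (hb : 0 < b) :
    Integrable (fun z : ℂ => Real.exp (-b * ‖z‖ ^ 2)) := by
  have h := (GaussianFourier.integrable_cexp_neg_mul_sq_norm_add (V := ℂ) (b := (b : ℂ))
    (by simpa using hb) 0 0).norm
  refine h.congr (Eventually.of_forall fun z => ?_)
  simp only [Complex.norm_exp]
  congr 1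
  rw [zero_mul, add_zero]
  norm_cast

/-- Completing the square spends half of the Gaussian decay on the exponential. All later
integrability and domination rests on this. -/
theorem integrable_exp_mul_norm_complexNoise (c : ℝ) :
    Integrable (fun z : ℂ => Real.exp (c * ‖z‖)) complexNoise := by
  rw [integrable_complexNoise_iff]
  refine ((integrable_exp_neg_mul_norm_sq (b := 1 / 2) (by norm_num)).const_mul
    (Real.exp (c ^ 2 / 2) * (1 / Real.pi))).mono' (by fun_prop)
    (Eventually.of_forall fun z => ?_)
  rw [Real.norm_of_nonneg (by positivity)]
  have h : Real.exp (c * ‖z‖) * Real.exp (-‖z‖ ^ 2) ≤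
      Real.exp (c ^ 2 / 2) * Real.exp (-(1 / 2) * ‖z‖ ^ 2) := by
    rw [← Real.exp_add, ← Real.exp_add]
    exact Real.exp_le_exp.2 (by nlinarith [sq_nonneg (c - ‖z‖)])
  calc _ = 1 / Real.pi * (Real.exp (c * ‖z‖) * Real.exp (-‖z‖ ^ 2)) := by ring
    _ ≤ 1 / Real.pi * (Real.exp (c ^ 2 / 2) * Real.exp (-(1 / 2) * ‖z‖ ^ 2)) := by gcongr
    _ = _ := by ring

theorem integrable_complexNoise_of_abs_le {f : ℂ → ℝ} (hf : Continuous f) (K c : ℝ)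
    (h : ∀ z, |f z| ≤ K * Real.exp (c * ‖z‖)) : Integrable f complexNoise :=
  ((integrable_exp_mul_norm_complexNoise c).const_mul K).mono' hf.aestronglyMeasurable
    (Eventually.of_forall h)

/-- The exponential tilt of the noise law is its translate. -/
theorem integral_complexNoise_translate (f : ℂ → ℝ) (a : ℂ) :
    ∫ z, f (a + z) ∂complexNoise =
      ∫ y, Real.exp (2 * (a.re * y.re + a.im * y.im) - ‖a‖ ^ 2) * f y ∂complexNoise := by
  rw [integral_complexNoise, integral_complexNoise,
    ← integral_add_left_eq_self (fun y : ℂ => 1 / Real.pi * Real.exp (-‖y‖ ^ 2) *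
      (Real.exp (2 * (a.re * y.re + a.im * y.im) - ‖a‖ ^ 2) * f y)) a]
  refine integral_congr_ae (Eventually.of_forall fun z => ?_)
  simp only
  have h : Real.exp (-‖z‖ ^ 2) = Real.exp (-‖a + z‖ ^ 2) *
      Real.exp (2 * (a.re * (a + z).re + a.im * (a + z).im) - ‖a‖ ^ 2) := by
    rw [← Real.exp_add]
    congr 1
    simp only [Complex.sq_norm, Complex.normSq_apply, Complex.add_re, Complex.add_im]
    ring
  rw [h]
  ring

/-! ### Moments of the noise -/

theorem integral_even_pow_mul_exp_neg_sq (n : ℕ) :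
    ∫ x : ℝ, x ^ (2 * n) * Real.exp (-x ^ 2) = Real.Gamma (n + 1 / 2) := by
  have h := integral_comp_abs (f := fun x : ℝ => x ^ (2 * n) * Real.exp (-x ^ 2))
  simp only [sq_abs, pow_mul] at h ⊢
  rw [h]
  have h2 := integral_rpow_mul_exp_neg_rpow (p := 2) (q := (2 * n : ℕ)) (by norm_num)
    (by have : (0 : ℝ) ≤ (2 * n : ℕ) := Nat.cast_nonneg _
        linarith)
  have h3 : ∀ x : ℝ, x ^ (2 : ℝ) = x ^ 2 := fun x => by norm_cast
  simp only [Real.rpow_natCast, h3, pow_mul] at h2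
  rw [h2]
  push_cast
  rw [show (2 * (n : ℝ) + 1) / 2 = n + 1 / 2 by ring]
  ring

theorem integral_odd_pow_mul_exp_neg_sq (n : ℕ) :
    ∫ x : ℝ, x ^ (2 * n + 1) * Real.exp (-x ^ 2) = 0 := by
  have h := integral_neg_eq_self (fun x : ℝ => x ^ (2 * n + 1) * Real.exp (-x ^ 2)) volume
  have h2 : ∀ x : ℝ, (-x) ^ (2 * n + 1) * Real.exp (-(-x) ^ 2) =
      -(x ^ (2 * n + 1) * Real.exp (-x ^ 2)) := fun x => by
    rw [Odd.neg_pow ⟨n, rfl⟩, neg_sq]; ring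
  simp only [h2, integral_neg] at h
  linarith

theorem integral_re_pow_mul_im_pow_complexNoise (i j : ℕ) :
    ∫ z : ℂ, z.re ^ i * z.im ^ j ∂complexNoise =
      1 / Real.pi * ((∫ x : ℝ, x ^ i * Real.exp (-x ^ 2)) *
        ∫ x : ℝ, x ^ j * Real.exp (-x ^ 2)) := by
  rw [integral_complexNoise, ← integral_prod_mul, ← integral_const_mul,
    ← Measure.volume_eq_prod,
    ← Complex.volume_preserving_equiv_real_prod.symm.integral_comp
      (Complex.measurableEquivRealProd.symm.measurableEmbedding)]
  refine integral_congr_ae (Eventually.of_forall fun z => ?_)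
  simp only [Complex.measurableEquivRealProd_symm_apply]
  rw [Complex.sq_norm, Complex.normSq_apply, neg_add, Real.exp_add]
  simp only [← pow_two]
  ring

theorem integrable_re_pow_mul_im_pow_complexNoise (i j : ℕ) :
    Integrable (fun z : ℂ => z.re ^ i * z.im ^ j) complexNoise := by
  refine integrable_complexNoise_of_abs_le (by fun_prop) 1 (i + j) fun z => ?_
  have h : ‖z‖ ≤ Real.exp ‖z‖ := by linarith [Real.add_one_le_exp ‖z‖]
  rw [abs_mul, abs_pow, abs_pow, one_mul, add_mul, Real.exp_add, Real.exp_nat_mul,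
    Real.exp_nat_mul]
  gcongr
  · exact (Complex.abs_re_le_norm z).trans h
  · exact (Complex.abs_im_le_norm z).trans h

theorem integral_pow_mul_exp_neg_sq_values :
    (∫ x : ℝ, x ^ 0 * Real.exp (-x ^ 2)) = √Real.pi ∧
    (∫ x : ℝ, x ^ 1 * Real.exp (-x ^ 2)) = 0 ∧
    (∫ x : ℝ, x ^ 2 * Real.exp (-x ^ 2)) = √Real.pi / 2 ∧
    (∫ x : ℝ, x ^ 3 * Real.exp (-x ^ 2)) = 0 ∧
    (∫ x : ℝ, x ^ 4 * Real.exp (-x ^ 2)) = 3 * √Real.pi / 4 := by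
  have g1 : Real.Gamma (1 + 1 / 2) = √Real.pi / 2 := by
    rw [add_comm, Real.Gamma_add_one (by norm_num), Real.Gamma_one_half_eq]; ring
  refine ⟨?_, ?_, ?_, ?_, ?_⟩
  · have := integral_even_pow_mul_exp_neg_sq 0
    rwa [Nat.cast_zero, zero_add, Real.Gamma_one_half_eq] at this
  · exact integral_odd_pow_mul_exp_neg_sq 0
  · have := integral_even_pow_mul_exp_neg_sq 1
    rwa [Nat.cast_one, g1] at this
  · exact integral_odd_pow_mul_exp_neg_sq 1
  · have := integral_even_pow_mul_exp_neg_sq 2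
    rw [show ((2 : ℕ) : ℝ) + 1 / 2 = (1 + 1 / 2) + 1 by norm_num,
      Real.Gamma_add_one (by norm_num), g1] at this
    rw [this]; ring

/-- Second moment of a quadratic form in the noise, centred at `m`. -/
theorem integral_quadratic_sub_sq_complexNoise (A B D m : ℝ) :
    ∫ z : ℂ, (2 * (A * z.re ^ 2 + 2 * B * (z.re * z.im) + D * z.im ^ 2) - m) ^ 2
      ∂complexNoise =
    3 * A ^ 2 + 4 * B ^ 2 + 3 * D ^ 2 + 2 * (A * D) - 2 * m * (A + D) + m ^ 2 := by
  have I := integrable_re_pow_mul_im_pow_complexNoise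
  obtain ⟨e0, e1, e2, e3, e4⟩ := integral_pow_mul_exp_neg_sq_values
  -- Zeroth powers are kept so that the product moment formula applies to every monomial.
  have hexp : ∀ z : ℂ,
      (2 * (A * z.re ^ 2 + 2 * B * (z.re * z.im) + D * z.im ^ 2) - m) ^ 2 =
      4 * A ^ 2 * (z.re ^ 4 * z.im ^ 0) + 16 * (A * B) * (z.re ^ 3 * z.im ^ 1)
      + (16 * B ^ 2 + 8 * (A * D)) * (z.re ^ 2 * z.im ^ 2)
      + 16 * (B * D) * (z.re ^ 1 * z.im ^ 3) + 4 * D ^ 2 * (z.re ^ 0 * z.im ^ 4)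
      + -(4 * m * A) * (z.re ^ 2 * z.im ^ 0) + -(8 * m * B) * (z.re ^ 1 * z.im ^ 1)
      + -(4 * m * D) * (z.re ^ 0 * z.im ^ 2) + m ^ 2 * (z.re ^ 0 * z.im ^ 0) := fun z => by ring
  simp only [hexp]
  rw [integral_add (by fun_prop) (by fun_prop), integral_add (by fun_prop) (by fun_prop),
    integral_add (by fun_prop) (by fun_prop), integral_add (by fun_prop) (by fun_prop),
    integral_add (by fun_prop) (by fun_prop), integral_add (by fun_prop) (by fun_prop),
    integral_add (by fun_prop) (by fun_prop), integral_add (by fun_prop) (by fun_prop)]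
  simp only [integral_const_mul, integral_re_pow_mul_im_pow_complexNoise, e0, e1, e2, e3, e4]
  have hpi : √Real.pi * √Real.pi = Real.pi := Real.mul_self_sqrt Real.pi_pos.le
  have hpi' := Real.pi_ne_zero
  field_simp
  rw [Real.sq_sqrt Real.pi_pos.le]
  field_simp
  ring

/-! ### Elementary inequalities -/

/-- From `1 - t ≤ exp (-t)` one gets `exp t - 1 ≤ t exp t`, hence `exp t - 1 - t ≤ t (exp t - 1)`;
the sign of `t` decides how the last factor is bounded. -/
theorem abs_exp_sub_one_sub_self_le (t : ℝ) :
    |Real.exp t - 1 - t| ≤ t ^ 2 * Real.exp |t| := by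
  have h1 := Real.add_one_le_exp t
  have h2 := Real.add_one_le_exp (-t)
  have h3 : Real.exp (-t) * Real.exp t = 1 := by rw [← Real.exp_add]; simp
  have h4 : Real.exp t - 1 ≤ t * Real.exp t := by
    nlinarith [Real.exp_pos t, mul_le_mul_of_nonneg_right h2 (Real.exp_pos t).le]
  rw [abs_of_nonneg (by linarith)]
  rcases le_total 0 t with ht | ht
  · rw [abs_of_nonneg ht]
    nlinarith
  · have h5 : 1 ≤ Real.exp |t| := Real.one_le_exp (abs_nonneg t)
    nlinarith [sq_nonneg t]

theorem mul_log_sub_sub_one_nonneg {x : ℝ} (hx : 0 < x) :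
    0 ≤ x * Real.log x - (x - 1) := by
  have := Real.self_sub_one_le_mul_log hx.le
  linarith

/-- This follows from `log x ≤ x - 1` and needs no closeness to `1`, so it can dominate where the
likelihood ratio is large. -/
theorem mul_log_sub_sub_one_le_sq {x : ℝ} (hx : 0 < x) :
    x * Real.log x - (x - 1) ≤ (x - 1) ^ 2 := by
  nlinarith [mul_le_mul_of_nonneg_left (Real.log_le_sub_one_of_pos hx) hx.le]

theorem abs_mul_log_sub_sub_half_sq_le {d : ℝ} (hd : |d| ≤ 1 / 2) :
    |(1 + d) * Real.log (1 + d) - d - d ^ 2 / 2| ≤ 4 * |d| ^ 3 := by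
  -- Two terms of the logarithm series leave a remainder `|d|³ / (1 - |d|) ≤ 2|d|³`. Multiplying by
  -- `|1 + d| ≤ 3/2` and adding `|d|³/2` stays below `4|d|³`.
  have h := Real.abs_log_sub_add_sum_range_le (x := -d) (by rw [abs_neg]; linarith) 2
  simp only [Finset.sum_range_succ, Finset.sum_range_zero, abs_neg, sub_neg_eq_add] at h
  norm_num at h
  have h0 := abs_nonneg d
  have hR : |-d + d ^ 2 / 2 + Real.log (1 + d)| ≤ 2 * |d| ^ 3 := by
    refine h.trans ?_
    rw [div_le_iff₀ (by linarith)]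
    nlinarith [pow_nonneg h0 3]
  have e : (1 + d) * Real.log (1 + d) - d - d ^ 2 / 2 =
      (1 + d) * (-d + d ^ 2 / 2 + Real.log (1 + d)) - d ^ 3 / 2 := by ring
  rw [e]
  refine (abs_sub _ _).trans ?_
  rw [abs_mul, abs_div, abs_pow]
  have h1 : |1 + d| ≤ 3 / 2 := by
    refine (abs_add_le _ _).trans ?_
    rw [abs_one]; linarith
  have := mul_le_mul h1 hR (abs_nonneg _) (by norm_num)
  rw [abs_two]
  nlinarith [pow_nonneg h0 3]

theorem tendsto_mul_log_sub_div_pow_four {L : ℝ → ℝ} {a : ℝ}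
    (h : Tendsto (fun s => (L s - 1) / s ^ 2) (𝓝[>] 0) (𝓝 a)) :
    Tendsto (fun s => (L s * Real.log (L s) - (L s - 1)) / s ^ 4) (𝓝[>] 0) (𝓝 (a ^ 2 / 2)) := by
  have hpos : ∀ᶠ s : ℝ in 𝓝[>] 0, 0 < s := self_mem_nhdsWithin
  have hs : Tendsto (fun s : ℝ => s ^ 2) (𝓝[>] 0) (𝓝 0) := by
    have : Tendsto (fun s : ℝ => s ^ 2) (𝓝 0) (𝓝 (0 ^ 2)) := (continuous_pow 2).tendsto 0
    simpa using this.mono_left nhdsWithin_le_nhds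
  have hd : Tendsto (fun s => L s - 1) (𝓝[>] 0) (𝓝 0) := by
    have := h.mul hs
    rw [mul_zero] at this
    refine this.congr' ?_
    filter_upwards [hpos] with s hs0
    field_simp
  have hsmall : ∀ᶠ s in 𝓝[>] (0 : ℝ), |L s - 1| ≤ 1 / 2 := by
    have := hd.abs
    rw [abs_zero] at this
    exact this.eventually_le_const (by norm_num)
  have hmain : Tendsto (fun s => (L s * Real.log (L s) - (L s - 1)) / s ^ 4 -
      ((L s - 1) / s ^ 2) ^ 2 / 2) (𝓝[>] 0) (𝓝 0) := by
    have hb : Tendsto (fun s => 4 * |L s - 1| * ((L s - 1) / s ^ 2) ^ 2) (𝓝[>] 0) (𝓝 0) := by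
      simpa using (hd.abs.const_mul 4).mul (h.pow 2)
    refine squeeze_zero_norm' ?_ hb
    filter_upwards [hpos, hsmall] with s hs0 hsm
    have := abs_mul_log_sub_sub_half_sq_le hsm
    rw [show 1 + (L s - 1) = L s by ring] at this
    have e : (L s * Real.log (L s) - (L s - 1)) / s ^ 4 - ((L s - 1) / s ^ 2) ^ 2 / 2 =
        (L s * Real.log (L s) - (L s - 1) - (L s - 1) ^ 2 / 2) / s ^ 4 := by
      field_simp
    rw [e, Real.norm_eq_abs, abs_div, abs_of_pos (show 0 < s ^ 4 by positivity),
      div_le_iff₀ (by positivity)]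
    refine this.trans (le_of_eq ?_)
    rw [show |L s - 1| ^ 3 = |L s - 1| * (L s - 1) ^ 2 by rw [← sq_abs]; ring]
    field_simp
  have := hmain.add ((h.pow 2).div_const 2)
  simpa using this

/-- The exponent is `O(s)`, so its second-order Taylor error is `o(s²)`. The linear term is removed
by hand because it cancels only after averaging over a zero-mean input. -/
theorem tendsto_exp_sub_one_sub_div_sq (c d : ℝ) :
    Tendsto (fun s : ℝ => (Real.exp (2 * (s * c) - s ^ 2 * d) - 1 - 2 * (s * c)) / s ^ 2)
      (𝓝[>] 0) (𝓝 (2 * c ^ 2 - d)) := by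
  have hpos : ∀ᶠ s : ℝ in 𝓝[>] 0, 0 < s := self_mem_nhdsWithin
  have hc : Continuous (fun s : ℝ => 2 * (s * c) - s ^ 2 * d) := by fun_prop
  have ht : Tendsto (fun s : ℝ => 2 * (s * c) - s ^ 2 * d) (𝓝[>] 0) (𝓝 0) := by
    have := hc.tendsto 0
    simpa using this.mono_left nhdsWithin_le_nhds
  have ho := (Real.exp_sub_sum_range_succ_isLittleO_pow 2).comp_tendsto ht
  have hO : (fun s : ℝ => (2 * (s * c) - s ^ 2 * d) ^ 2) =O[𝓝[>] 0] fun s => s ^ 2 := by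
    have hb : (fun s : ℝ => 2 * c - s * d) =O[𝓝[>] 0] fun _ => (1 : ℝ) := by
      have hc : Continuous (fun s : ℝ => 2 * c - s * d) := by fun_prop
      exact ((hc.tendsto 0).mono_left nhdsWithin_le_nhds).isBigO_one ℝ
    have := ((isBigO_refl (fun s : ℝ => s) (𝓝[>] 0)).mul hb).pow 2
    refine (this.congr_left fun s => ?_).congr_right fun s => ?_
    · ring
    · ring
  have h1 := (ho.trans_isBigO hO).tendsto_div_nhds_zero
  -- With `t` the exponent, this polynomial is `(t + t²/2 - 2sc) / s²`.
  have hq : Continuous (fun s : ℝ => 2 * c ^ 2 - d - 2 * s * c * d + s ^ 2 * d ^ 2 / 2) := by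
    fun_prop
  have h2 := (hq.tendsto 0).mono_left (nhdsWithin_le_nhds (s := Set.Ioi 0))
  have h3 := h1.add h2
  simp only [mul_zero, zero_mul, ne_eq, OfNat.ofNat_ne_zero, not_false_eq_true, zero_pow,
    zero_div, sub_zero, add_zero, zero_add] at h3
  refine h3.congr' ?_
  filter_upwards [hpos] with s hs0
  simp only [Function.comp_apply, Finset.sum_range_succ, Finset.sum_range_zero, Nat.factorial]
  field_simp
  push_cast
  ring

/-! ### The likelihood ratio of the channel output -/

/-- Log-likelihood ratio at `y` of the translate by `s x` of the noise law. -/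
noncomputable def logTilt (s : ℝ) (x y : ℂ) : ℝ :=
  2 * (s * (x.re * y.re + x.im * y.im)) - s ^ 2 * ‖x‖ ^ 2

/-- Density of the law of `s X + Z` with respect to the law of `Z`. -/
noncomputable def likelihoodRatio (S : Finset ℂ) (P : ℂ → ℝ) (s : ℝ) (y : ℂ) : ℝ :=
  ∑ x ∈ S, P x * Real.exp (logTilt s x y)

@[fun_prop]
theorem continuous_logTilt (s : ℝ) (x : ℂ) : Continuous (logTilt s x) := by
  unfold logTilt; fun_prop

@[fun_prop]
theorem continuous_likelihoodRatio (S : Finset ℂ) (P : ℂ → ℝ) (s : ℝ) :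
    Continuous (likelihoodRatio S P s) := by
  unfold likelihoodRatio; fun_prop

/-- A common bound for the growth of the functions `logTilt s x`, `x ∈ S`. -/
noncomputable def tiltBound (S : Finset ℂ) : ℝ :=
  2 * (∑ x ∈ S, ‖x‖) + (∑ x ∈ S, ‖x‖) ^ 2

theorem tiltBound_nonneg (S : Finset ℂ) : 0 ≤ tiltBound S := by
  have : 0 ≤ ∑ x ∈ S, ‖x‖ := Finset.sum_nonneg fun x _ => norm_nonneg x
  unfold tiltBound; positivity

theorem abs_re_mul_re_add_im_mul_im_le (x y : ℂ) :
    |x.re * y.re + x.im * y.im| ≤ ‖x‖ * ‖y‖ := by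
  have h := Complex.abs_re_le_norm ((starRingEnd ℂ) x * y)
  rw [norm_mul, Complex.norm_conj] at h
  simpa [Complex.mul_re] using h

/-- A full factor `s` is retained, using `s² ≤ s`; its square supplies the `s²` in the bound on `L -
1`. -/
theorem abs_logTilt_le {S : Finset ℂ} {x : ℂ} (hx : x ∈ S) {s : ℝ} (hs0 : 0 ≤ s) (hs1 : s ≤ 1)
    (y : ℂ) : |logTilt s x y| ≤ s * (tiltBound S * (1 + ‖y‖)) := by
  set R := ∑ x ∈ S, ‖x‖ with hR
  have hxR : ‖x‖ ≤ R := Finset.single_le_sum (f := fun x : ℂ => ‖x‖) (fun x _ => norm_nonneg x) hx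
  have hR0 : 0 ≤ R := (norm_nonneg x).trans hxR
  have h1 : |x.re * y.re + x.im * y.im| ≤ R * ‖y‖ :=
    (abs_re_mul_re_add_im_mul_im_le x y).trans (by gcongr)
  have h2 : ‖x‖ ^ 2 ≤ R ^ 2 := by gcongr
  have h3 : s ^ 2 * ‖x‖ ^ 2 ≤ s * R ^ 2 := by
    have : s ^ 2 ≤ s := by nlinarith
    gcongr
  unfold logTilt
  refine (abs_sub _ _).trans ?_
  rw [abs_mul, abs_mul, abs_two, abs_of_nonneg hs0,
    abs_of_nonneg (show 0 ≤ s ^ 2 * ‖x‖ ^ 2 by positivity)]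
  have h4 := mul_le_mul_of_nonneg_left h1 hs0
  have : s * (tiltBound S * (1 + ‖y‖)) =
      2 * (s * (R * ‖y‖)) + s * R ^ 2 + (2 * s * R + s * R ^ 2 * ‖y‖) := by
    unfold tiltBound; rw [← hR]; ring
  rw [this]
  have h5 : 0 ≤ 2 * s * R + s * R ^ 2 * ‖y‖ := by positivity
  linarith

section

variable {S : Finset ℂ} {P : ℂ → ℝ}

theorem likelihoodRatio_mem_Icc (hP : ∀ x ∈ S, 0 ≤ P x) (hP1 : ∑ x ∈ S, P x = 1)
    {s : ℝ} (hs0 : 0 ≤ s) (hs1 : s ≤ 1) (y : ℂ) :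
    likelihoodRatio S P s y ∈ Set.Icc (Real.exp (-(tiltBound S * (1 + ‖y‖))))
      (Real.exp (tiltBound S * (1 + ‖y‖))) := by
  have hK : 0 ≤ tiltBound S * (1 + ‖y‖) := mul_nonneg (tiltBound_nonneg S) (by positivity)
  have hb : ∀ x ∈ S, |logTilt s x y| ≤ tiltBound S * (1 + ‖y‖) := fun x hx =>
    (abs_logTilt_le hx hs0 hs1 y).trans (mul_le_of_le_one_left hK hs1)
  constructor
  · calc _ = ∑ x ∈ S, P x * Real.exp (-(tiltBound S * (1 + ‖y‖))) := by
          rw [← Finset.sum_mul, hP1, one_mul]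
      _ ≤ _ := Finset.sum_le_sum fun x hx => mul_le_mul_of_nonneg_left
          (Real.exp_le_exp.2 (neg_le_of_abs_le (hb x hx))) (hP x hx)
  · calc _ ≤ ∑ x ∈ S, P x * Real.exp (tiltBound S * (1 + ‖y‖)) :=
          Finset.sum_le_sum fun x hx => mul_le_mul_of_nonneg_left
            (Real.exp_le_exp.2 (le_of_abs_le (hb x hx))) (hP x hx)
      _ = _ := by rw [← Finset.sum_mul, hP1, one_mul]

theorem likelihoodRatio_pos (hP : ∀ x ∈ S, 0 ≤ P x) (hP1 : ∑ x ∈ S, P x = 1)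
    {s : ℝ} (hs0 : 0 ≤ s) (hs1 : s ≤ 1) (y : ℂ) : 0 < likelihoodRatio S P s y :=
  (Real.exp_pos _).trans_le (likelihoodRatio_mem_Icc hP hP1 hs0 hs1 y).1

theorem abs_log_likelihoodRatio_le (hP : ∀ x ∈ S, 0 ≤ P x) (hP1 : ∑ x ∈ S, P x = 1)
    {s : ℝ} (hs0 : 0 ≤ s) (hs1 : s ≤ 1) (y : ℂ) :
    |Real.log (likelihoodRatio S P s y)| ≤ tiltBound S * Real.exp ‖y‖ := by
  obtain ⟨h1, h2⟩ := likelihoodRatio_mem_Icc hP hP1 hs0 hs1 y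
  have hpos := likelihoodRatio_pos hP hP1 hs0 hs1 y
  have h3 : |Real.log (likelihoodRatio S P s y)| ≤ tiltBound S * (1 + ‖y‖) :=
    abs_le.2 ⟨(Real.le_log_iff_exp_le hpos).2 h1, (Real.log_le_iff_le_exp hpos).2 h2⟩
  refine h3.trans (mul_le_mul_of_nonneg_left ?_ (tiltBound_nonneg S))
  linarith [Real.add_one_le_exp ‖y‖]

theorem continuous_log_likelihoodRatio (hP : ∀ x ∈ S, 0 ≤ P x) (hP1 : ∑ x ∈ S, P x = 1)
    {s : ℝ} (hs0 : 0 ≤ s) (hs1 : s ≤ 1) :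
    Continuous fun y => Real.log (likelihoodRatio S P s y) :=
  (continuous_likelihoodRatio S P s).log fun y => (likelihoodRatio_pos hP hP1 hs0 hs1 y).ne'

theorem integrable_exp_logTilt_mul {f : ℂ → ℝ} (hf : Continuous f) (C : ℝ)
    (h : ∀ y, |f y| ≤ C * Real.exp ‖y‖) {x : ℂ} (hx : x ∈ S) {s : ℝ} (hs0 : 0 ≤ s)
    (hs1 : s ≤ 1) :
    Integrable (fun y => Real.exp (logTilt s x y) * f y) complexNoise := by
  refine integrable_complexNoise_of_abs_le (by fun_prop) (Real.exp (tiltBound S) * C)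
    (tiltBound S + 1) fun y => ?_
  have hK : 0 ≤ tiltBound S * (1 + ‖y‖) := mul_nonneg (tiltBound_nonneg S) (by positivity)
  have h1 : Real.exp (logTilt s x y) ≤ Real.exp (tiltBound S * (1 + ‖y‖)) :=
    Real.exp_le_exp.2 ((le_abs_self _).trans ((abs_logTilt_le hx hs0 hs1 y).trans
      (mul_le_of_le_one_left hK hs1)))
  rw [abs_mul, abs_of_pos (Real.exp_pos _)]
  refine (mul_le_mul h1 (h y) (abs_nonneg _) (Real.exp_pos _).le).trans (le_of_eq ?_)
  rw [mul_add, mul_one, Real.exp_add, add_mul, Real.exp_add, one_mul]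
  ring

theorem integral_translate_complexNoise (f : ℂ → ℝ) (s : ℝ) (x : ℂ) :
    ∫ z, f ((s : ℂ) * x + z) ∂complexNoise =
      ∫ y, Real.exp (logTilt s x y) * f y ∂complexNoise := by
  rw [integral_complexNoise_translate]
  refine integral_congr_ae (Eventually.of_forall fun y => ?_)
  simp only [logTilt, Complex.re_ofReal_mul, Complex.im_ofReal_mul, norm_mul,
    Complex.norm_real, Real.norm_eq_abs, mul_pow, sq_abs]
  congr 2
  ring

theorem integral_one_complexNoise : ∫ _ : ℂ, (1 : ℝ) ∂complexNoise = 1 := by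
  have h := integral_re_pow_mul_im_pow_complexNoise 0 0
  rw [integral_pow_mul_exp_neg_sq_values.1, Real.mul_self_sqrt Real.pi_pos.le,
    one_div_mul_cancel Real.pi_ne_zero] at h
  simpa using h

theorem integral_re_complexNoise : ∫ z : ℂ, z.re ∂complexNoise = 0 := by
  have h := integral_re_pow_mul_im_pow_complexNoise 1 0
  rw [integral_pow_mul_exp_neg_sq_values.2.1, zero_mul, mul_zero] at h
  simpa using h

theorem integral_im_complexNoise : ∫ z : ℂ, z.im ∂complexNoise = 0 := by
  have h := integral_re_pow_mul_im_pow_complexNoise 0 1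
  rw [integral_pow_mul_exp_neg_sq_values.2.1, mul_zero, mul_zero] at h
  simpa using h

theorem integrable_linear_complexNoise (a b c : ℝ) :
    Integrable (fun z : ℂ => a * z.re + b * z.im + c) complexNoise := by
  have h := integrable_re_pow_mul_im_pow_complexNoise
  have h10 := h 1 0
  have h01 := h 0 1
  have h00 := h 0 0
  simp only [pow_one, pow_zero, mul_one, one_mul] at h10 h01 h00
  simpa using! ((h10.const_mul a).add (h01.const_mul b)).add (h00.const_mul c)

theorem integral_linear_complexNoise (a b c : ℝ) :
    ∫ z : ℂ, (a * z.re + b * z.im + c) ∂complexNoise = c := by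
  have h1 := integrable_linear_complexNoise a 0 0
  have h2 := integrable_linear_complexNoise 0 b 0
  have h3 := integrable_linear_complexNoise 0 0 c
  have h12 := integrable_linear_complexNoise a b 0
  simp only [zero_mul, add_zero, zero_add] at h1 h2 h3 h12
  rw [integral_add h12 h3, integral_add h1 h2, integral_const_mul, integral_const_mul,
    integral_re_complexNoise, integral_im_complexNoise, ← mul_one c, integral_const_mul,
    integral_one_complexNoise]
  ring

/-- The capacity is the signal energy minus the relative entropy of the output law with respect
to the noise law. -/
theorem constrainedCapacity_sq (hP : ∀ x ∈ S, 0 ≤ P x) (hP1 : ∑ x ∈ S, P x = 1)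
    {s : ℝ} (hs0 : 0 ≤ s) (hs1 : s ≤ 1) :
    constrainedCapacity S P (s ^ 2) = s ^ 2 * secondMoment S P -
      ∫ y, (likelihoodRatio S P s y * Real.log (likelihoodRatio S P s y) -
        (likelihoodRatio S P s y - 1)) ∂complexNoise := by
  set L := likelihoodRatio S P s with hL
  have hlogc : Continuous fun y => Real.log (L y) :=
    continuous_log_likelihoodRatio hP hP1 hs0 hs1
  have hlogb : ∀ y, |Real.log (L y)| ≤ tiltBound S * Real.exp ‖y‖ :=
    abs_log_likelihoodRatio_le hP hP1 hs0 hs1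
  have hone : ∀ y : ℂ, |(1 : ℝ)| ≤ 1 * Real.exp ‖y‖ := fun y => by
    rw [abs_one, one_mul]; exact Real.one_le_exp (norm_nonneg y)
  -- Given `X = x`, the argument of the logarithm is `L(sx + z)` divided by the tilt of `x` at `sx +
  -- z`. The logarithm of that tilt is affine in `z` with mean `s²|x|²`.
  have hint : ∀ x ∈ S, ∫ z, Real.log (∑ x' ∈ S, P x' *
      Real.exp (-‖(s : ℂ) * (x - x') + z‖ ^ 2 + ‖z‖ ^ 2)) ∂complexNoise =
      ∫ y, Real.exp (logTilt s x y) * Real.log (L y) ∂complexNoise - s ^ 2 * ‖x‖ ^ 2 := by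
    intro x hx
    have hpt : ∀ z : ℂ, Real.log (∑ x' ∈ S, P x' *
        Real.exp (-‖(s : ℂ) * (x - x') + z‖ ^ 2 + ‖z‖ ^ 2)) =
        Real.log (L ((s : ℂ) * x + z)) -
          (2 * s * x.re * z.re + 2 * s * x.im * z.im + s ^ 2 * ‖x‖ ^ 2) := by
      intro z
      have hsum : ∑ x' ∈ S, P x' * Real.exp (-‖(s : ℂ) * (x - x') + z‖ ^ 2 + ‖z‖ ^ 2) =
          L ((s : ℂ) * x + z) * Real.exp
            (-(2 * s * x.re * z.re + 2 * s * x.im * z.im + s ^ 2 * ‖x‖ ^ 2)) := by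
        rw [hL, likelihoodRatio, Finset.sum_mul]
        refine Finset.sum_congr rfl fun x' _ => ?_
        rw [mul_assoc, ← Real.exp_add]
        congr 2
        simp only [logTilt, Complex.sq_norm, Complex.normSq_apply, Complex.add_re,
          Complex.add_im, Complex.re_ofReal_mul, Complex.im_ofReal_mul, Complex.sub_re,
          Complex.sub_im]
        ring
      rw [hsum, Real.log_mul (likelihoodRatio_pos hP hP1 hs0 hs1 _).ne' (Real.exp_pos _).ne',
        Real.log_exp]
      ring
    have hintegrable : Integrable (fun z => Real.log (L ((s : ℂ) * x + z))) complexNoise := by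
      refine integrable_complexNoise_of_abs_le
        (hlogc.comp (by fun_prop : Continuous fun z : ℂ => (s : ℂ) * x + z))
        (tiltBound S * Real.exp ‖(s : ℂ) * x‖) 1 fun z => (hlogb _).trans ?_
      rw [one_mul, mul_assoc, ← Real.exp_add]
      exact mul_le_mul_of_nonneg_left (Real.exp_le_exp.2 (norm_add_le _ _)) (tiltBound_nonneg S)
    simp only [hpt]
    rw [integral_sub hintegrable (integrable_linear_complexNoise _ _ _),
      integral_linear_complexNoise, integral_translate_complexNoise fun y => Real.log (L y)]
  have hmul : ∀ f : ℂ → ℝ, (fun y => L y * f y) =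
      fun y => ∑ x ∈ S, P x * (Real.exp (logTilt s x y) * f y) := fun f => by
    funext y
    rw [hL, likelihoodRatio, Finset.sum_mul]
    exact Finset.sum_congr rfl fun x _ => by ring
  have hI : ∀ f : ℂ → ℝ, Continuous f → ∀ C, (∀ y, |f y| ≤ C * Real.exp ‖y‖) →
      Integrable (fun y => L y * f y) complexNoise ∧ ∫ y, L y * f y ∂complexNoise =
      ∑ x ∈ S, P x * ∫ y, Real.exp (logTilt s x y) * f y ∂complexNoise := by
    intro f hf C hC
    have hi : ∀ x ∈ S, Integrable (fun y => P x * (Real.exp (logTilt s x y) * f y))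
        complexNoise := fun x hx => (integrable_exp_logTilt_mul hf C hC hx hs0 hs1).const_mul _
    rw [hmul f]
    refine ⟨integrable_finsetSum S hi, ?_⟩
    rw [integral_finsetSum S hi]
    exact Finset.sum_congr rfl fun x _ => integral_const_mul _ _
  obtain ⟨hi1, he1⟩ := hI _ hlogc _ hlogb
  obtain ⟨hi2, he2⟩ := hI (fun _ => 1) continuous_const 1 hone
  have hi3 : Integrable (fun _ : ℂ => (1 : ℝ)) complexNoise := by
    simpa using integrable_linear_complexNoise 0 0 1
  -- As `L` is a probability density, subtracting `L - 1` costs nothing and makes the integrand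
  -- nonnegative.
  have hL1 : ∫ y, L y * 1 ∂complexNoise = 1 := by
    rw [he2]
    refine (Finset.sum_congr rfl fun x _ => ?_).trans hP1
    rw [← integral_translate_complexNoise fun _ => 1, integral_one_complexNoise, mul_one]
  simp only [mul_one] at hi2 hL1
  have hi23 : Integrable (fun y => L y - 1) complexNoise := hi2.sub hi3
  rw [integral_sub hi1 hi23, integral_sub hi2 hi3, hL1, integral_one_complexNoise,
    he1, constrainedCapacity, Real.sqrt_sq hs0, secondMoment,
    Finset.sum_congr rfl fun x hx => by rw [hint x hx, mul_sub],
    Finset.sum_sub_distrib, Finset.mul_sum]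
  have : ∀ x ∈ S, P x * (s ^ 2 * ‖x‖ ^ 2) = s ^ 2 * (‖x‖ ^ 2 * P x) := fun x _ => by ring
  rw [Finset.sum_congr rfl this]
  ring

/-! ### The low-SNR expansion -/

theorem sum_mul_re_add_im_eq_zero (hmean : ∑ x ∈ S, (P x : ℂ) * x = 0) (y : ℂ) :
    ∑ x ∈ S, P x * (x.re * y.re + x.im * y.im) = 0 := by
  have h1 := congrArg Complex.re hmean
  have h2 := congrArg Complex.im hmean
  simp only [Complex.re_sum, Complex.im_sum, Complex.re_ofReal_mul, Complex.im_ofReal_mul,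
    Complex.zero_re, Complex.zero_im] at h1 h2
  calc _ = (∑ x ∈ S, P x * x.re) * y.re + (∑ x ∈ S, P x * x.im) * y.im := by
        rw [Finset.sum_mul, Finset.sum_mul, ← Finset.sum_add_distrib]
        exact Finset.sum_congr rfl fun x _ => by ring
    _ = 0 := by rw [h1, h2]; ring

/-- Zero mean reduces the average of `logTilt` to `-s²` times the energy, so only Taylor remainders
of order `s²` are left besides it. Order `s²` rather than `s` is what keeps the relative entropy
integrand bounded after division by `s⁴`. -/
theorem abs_likelihoodRatio_sub_one_le (hP : ∀ x ∈ S, 0 ≤ P x) (hP1 : ∑ x ∈ S, P x = 1)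
    (hmean : ∑ x ∈ S, (P x : ℂ) * x = 0) {s : ℝ} (hs0 : 0 ≤ s) (hs1 : s ≤ 1) (y : ℂ) :
    |likelihoodRatio S P s y - 1| ≤ s ^ 2 *
      ((secondMoment S P + tiltBound S ^ 2 * Real.exp (tiltBound S + 2)) *
        Real.exp ((tiltBound S + 2) * ‖y‖)) := by
  set K := tiltBound S with hK
  have hK0 : 0 ≤ K := tiltBound_nonneg S
  have hm0 : 0 ≤ secondMoment S P :=
    Finset.sum_nonneg fun x hx => mul_nonneg (by positivity) (hP x hx)
  have e : likelihoodRatio S P s y - 1 =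
      ∑ x ∈ S, P x * (Real.exp (logTilt s x y) - 1 - logTilt s x y) -
        s ^ 2 * secondMoment S P := by
    have h1 : ∑ x ∈ S, P x * logTilt s x y = -(s ^ 2 * secondMoment S P) := by
      have h0 := sum_mul_re_add_im_eq_zero hmean y
      calc _ = 2 * s * ∑ x ∈ S, P x * (x.re * y.re + x.im * y.im) -
            s ^ 2 * ∑ x ∈ S, ‖x‖ ^ 2 * P x := by
            rw [Finset.mul_sum, Finset.mul_sum, ← Finset.sum_sub_distrib]
            exact Finset.sum_congr rfl fun x _ => by rw [logTilt]; ring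
        _ = _ := by rw [h0, secondMoment]; ring
    simp only [mul_sub, Finset.sum_sub_distrib, mul_one]
    rw [hP1, h1, likelihoodRatio]
    ring
  have hb : ∀ x ∈ S, |Real.exp (logTilt s x y) - 1 - logTilt s x y| ≤
      s ^ 2 * (K ^ 2 * Real.exp ((K + 2) * (1 + ‖y‖))) := by
    intro x hx
    have ht := abs_logTilt_le hx hs0 hs1 y
    rw [← hK] at ht
    have hu : 0 ≤ 1 + ‖y‖ := by positivity
    have ht' : |logTilt s x y| ≤ K * (1 + ‖y‖) :=
      ht.trans (mul_le_of_le_one_left (by positivity) hs1)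
    have h2 : logTilt s x y ^ 2 ≤ (s * (K * (1 + ‖y‖))) ^ 2 := by
      rw [← sq_abs]; gcongr
    -- Absorbing this polynomial factor turns the rate `K` into `K + 2`.
    have h3 : (1 + ‖y‖) ^ 2 ≤ Real.exp (2 * (1 + ‖y‖)) := by
      have : 1 + ‖y‖ ≤ Real.exp (1 + ‖y‖) := by linarith [Real.add_one_le_exp (1 + ‖y‖)]
      rw [two_mul, Real.exp_add, ← pow_two]
      gcongr
    calc _ ≤ logTilt s x y ^ 2 * Real.exp |logTilt s x y| := abs_exp_sub_one_sub_self_le _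
      _ ≤ (s * (K * (1 + ‖y‖))) ^ 2 * Real.exp (K * (1 + ‖y‖)) := by gcongr
      _ = s ^ 2 * (K ^ 2 * (Real.exp (K * (1 + ‖y‖)) * (1 + ‖y‖) ^ 2)) := by ring
      _ ≤ s ^ 2 * (K ^ 2 * (Real.exp (K * (1 + ‖y‖)) * Real.exp (2 * (1 + ‖y‖)))) := by gcongr
      _ = _ := by rw [← Real.exp_add, ← add_mul]
  have hsum : |∑ x ∈ S, P x * (Real.exp (logTilt s x y) - 1 - logTilt s x y)| ≤
      s ^ 2 * (K ^ 2 * Real.exp ((K + 2) * (1 + ‖y‖))) := by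
    refine (Finset.abs_sum_le_sum_abs _ _).trans ?_
    calc _ ≤ ∑ x ∈ S, P x * (s ^ 2 * (K ^ 2 * Real.exp ((K + 2) * (1 + ‖y‖)))) :=
          Finset.sum_le_sum fun x hx => by
            rw [abs_mul, abs_of_nonneg (hP x hx)]
            exact mul_le_mul_of_nonneg_left (hb x hx) (hP x hx)
      _ = _ := by rw [← Finset.sum_mul, hP1, one_mul]
  have h1 : 1 ≤ Real.exp ((K + 2) * ‖y‖) := Real.one_le_exp (by positivity)
  rw [e]
  refine (abs_sub _ _).trans ?_
  rw [abs_of_nonneg (show 0 ≤ s ^ 2 * secondMoment S P by positivity)]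
  have h4 : s ^ 2 * secondMoment S P ≤ s ^ 2 * (secondMoment S P * Real.exp ((K + 2) * ‖y‖)) := by
    gcongr
    exact le_mul_of_one_le_right hm0 h1
  have h5 : Real.exp ((K + 2) * (1 + ‖y‖)) = Real.exp (K + 2) * Real.exp ((K + 2) * ‖y‖) := by
    rw [← Real.exp_add]; congr 1; ring
  rw [h5] at hsum
  calc _ ≤ _ := add_le_add hsum h4
    _ = _ := by ring

theorem tendsto_likelihoodRatio_sub_one_div_sq (hP1 : ∑ x ∈ S, P x = 1)
    (hmean : ∑ x ∈ S, (P x : ℂ) * x = 0) (y : ℂ) :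
    Tendsto (fun s => (likelihoodRatio S P s y - 1) / s ^ 2) (𝓝[>] 0)
      (𝓝 (2 * ∑ x ∈ S, P x * (x.re * y.re + x.im * y.im) ^ 2 - secondMoment S P)) := by
  have h := tendsto_finsetSum S fun x _ => (tendsto_exp_sub_one_sub_div_sq
    (x.re * y.re + x.im * y.im) (‖x‖ ^ 2)).const_mul (P x)
  have e : ∑ x ∈ S, P x * (2 * (x.re * y.re + x.im * y.im) ^ 2 - ‖x‖ ^ 2) =
      2 * ∑ x ∈ S, P x * (x.re * y.re + x.im * y.im) ^ 2 - secondMoment S P := by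
    rw [secondMoment, Finset.mul_sum, ← Finset.sum_sub_distrib]
    exact Finset.sum_congr rfl fun x _ => by ring
  rw [e] at h
  refine h.congr fun s => ?_
  have h0 := sum_mul_re_add_im_eq_zero hmean y
  calc _ = (∑ x ∈ S, P x * Real.exp (logTilt s x y) - ∑ x ∈ S, P x -
        2 * s * ∑ x ∈ S, P x * (x.re * y.re + x.im * y.im)) / s ^ 2 := by
        rw [Finset.mul_sum, ← Finset.sum_sub_distrib, ← Finset.sum_sub_distrib, Finset.sum_div]
        exact Finset.sum_congr rfl fun x _ => by rw [logTilt]; ring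
    _ = _ := by rw [h0, hP1, likelihoodRatio]; ring

/-- The variance term of the expansion in terms of the energy and the pseudo-variance. -/
theorem integral_second_order_sq (S : Finset ℂ) (P : ℂ → ℝ) :
    ∫ y : ℂ, (2 * ∑ x ∈ S, P x * (x.re * y.re + x.im * y.im) ^ 2 - secondMoment S P) ^ 2
      ∂complexNoise =
    secondMoment S P ^ 2 + ‖∑ x ∈ S, (P x : ℂ) * x ^ 2‖ ^ 2 := by
  -- These are the real second moments: the energy is `A + D` and `E X² = (A - D) + 2iB`. The
  -- integral is `2A² + 4B² + 2D² = (A + D)² + (A - D)² + 4B²`.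
  set A := ∑ x ∈ S, P x * x.re ^ 2 with hA
  set B := ∑ x ∈ S, P x * (x.re * x.im) with hB
  set D := ∑ x ∈ S, P x * x.im ^ 2 with hD
  have hm : secondMoment S P = A + D := by
    rw [secondMoment, hA, hD, ← Finset.sum_add_distrib]
    refine Finset.sum_congr rfl fun x _ => ?_
    rw [Complex.sq_norm, Complex.normSq_apply]; ring
  have hQ : ∀ y : ℂ, ∑ x ∈ S, P x * (x.re * y.re + x.im * y.im) ^ 2 =
      A * y.re ^ 2 + 2 * B * (y.re * y.im) + D * y.im ^ 2 := by
    intro y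
    rw [hA, hB, hD, Finset.mul_sum, Finset.sum_mul, Finset.sum_mul, Finset.sum_mul,
      ← Finset.sum_add_distrib, ← Finset.sum_add_distrib]
    exact Finset.sum_congr rfl fun x _ => by ring
  have hre : (∑ x ∈ S, (P x : ℂ) * x ^ 2).re = A - D := by
    rw [Complex.re_sum, hA, hD, ← Finset.sum_sub_distrib]
    refine Finset.sum_congr rfl fun x _ => ?_
    rw [Complex.re_ofReal_mul, pow_two, Complex.mul_re]; ring
  have him : (∑ x ∈ S, (P x : ℂ) * x ^ 2).im = 2 * B := by
    rw [Complex.im_sum, hB, Finset.mul_sum]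
    refine Finset.sum_congr rfl fun x _ => ?_
    rw [Complex.im_ofReal_mul, pow_two, Complex.mul_im]; ring
  simp only [hQ]
  rw [integral_quadratic_sub_sq_complexNoise, Complex.sq_norm, Complex.normSq_apply, hre, him, hm]
  ring

theorem tendsto_relativeEntropy_div_pow_four (hP : ∀ x ∈ S, 0 ≤ P x) (hP1 : ∑ x ∈ S, P x = 1)
    (hmean : ∑ x ∈ S, (P x : ℂ) * x = 0) :
    Tendsto (fun s => (∫ y, (likelihoodRatio S P s y * Real.log (likelihoodRatio S P s y) -
        (likelihoodRatio S P s y - 1)) ∂complexNoise) / s ^ 4) (𝓝[>] 0)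
      (𝓝 ((secondMoment S P ^ 2 + ‖∑ x ∈ S, (P x : ℂ) * x ^ 2‖ ^ 2) / 2)) := by
  rw [← integral_second_order_sq, ← integral_div]
  simp only [← integral_div]
  set D := secondMoment S P + tiltBound S ^ 2 * Real.exp (tiltBound S + 2) with hD
  have hs01 : ∀ᶠ s : ℝ in 𝓝[>] 0, 0 < s ∧ s ≤ 1 := by
    filter_upwards [Ioc_mem_nhdsGT (zero_lt_one' ℝ)] with s hs using hs
  refine tendsto_integral_filter_of_dominated_convergence
    (fun y => D ^ 2 * Real.exp (2 * (tiltBound S + 2) * ‖y‖)) ?_ ?_ ?_ ?_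
  · filter_upwards [hs01] with s hs
    have := continuous_log_likelihoodRatio hP hP1 hs.1.le hs.2
    exact Continuous.aestronglyMeasurable (by fun_prop)
  · filter_upwards [hs01] with s hs
    refine Eventually.of_forall fun y => ?_
    have hpos := likelihoodRatio_pos hP hP1 hs.1.le hs.2 y
    have hs4 : 0 < s ^ 4 := pow_pos hs.1 4
    rw [Real.norm_of_nonneg (div_nonneg (mul_log_sub_sub_one_nonneg hpos) hs4.le),
      div_le_iff₀ hs4]
    refine (mul_log_sub_sub_one_le_sq hpos).trans ?_
    have := abs_likelihoodRatio_sub_one_le hP hP1 hmean hs.1.le hs.2 y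
    rw [← hD] at this
    rw [← sq_abs]
    refine (pow_le_pow_left₀ (abs_nonneg _) this 2).trans (le_of_eq ?_)
    rw [mul_assoc 2, two_mul, Real.exp_add]
    ring
  · exact (integrable_exp_mul_norm_complexNoise _).const_mul _
  · exact Eventually.of_forall fun y => tendsto_mul_log_sub_div_pow_four
      (tendsto_likelihoodRatio_sub_one_div_sq hP1 hmean y)

/-- Low-SNR expansion of the constrained capacity for zero-mean signalling. -/
theorem hasLowSNRExpansion_constrainedCapacity (hP : ∀ x ∈ S, 0 ≤ P x)
    (hP1 : ∑ x ∈ S, P x = 1) (hmean : ∑ x ∈ S, (P x : ℂ) * x = 0) :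
    HasLowSNRExpansion (constrainedCapacity S P) (secondMoment S P)
      (-(secondMoment S P ^ 2 + ‖∑ x ∈ S, (P x : ℂ) * x ^ 2‖ ^ 2) / 2) := by
  have hs01 : ∀ᶠ s : ℝ in 𝓝[>] 0, 0 < s ∧ s ≤ 1 := by
    filter_upwards [Ioc_mem_nhdsGT (zero_lt_one' ℝ)] with s hs using hs
  have hsqrt : Tendsto Real.sqrt (𝓝[>] 0) (𝓝[>] 0) := by
    refine tendsto_nhdsWithin_iff.2 ⟨?_, ?_⟩
    · have := Real.continuous_sqrt.tendsto 0
      rw [Real.sqrt_zero] at this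
      exact this.mono_left nhdsWithin_le_nhds
    · filter_upwards [self_mem_nhdsWithin] with s hs using Real.sqrt_pos.2 hs
  have h := ((tendsto_relativeEntropy_div_pow_four hP hP1 hmean).comp hsqrt).const_sub
    ((secondMoment S P ^ 2 + ‖∑ x ∈ S, (P x : ℂ) * x ^ 2‖ ^ 2) / 2)
  rw [sub_self] at h
  refine (isLittleO_iff_tendsto' ?_).2 (h.congr' ?_)
  · filter_upwards [hs01] with t ht h0
    exact absurd h0 (pow_pos ht.1 2).ne'
  · filter_upwards [hs01] with t ht
    have hc := constrainedCapacity_sq hP hP1 (Real.sqrt_nonneg t)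
      (Real.sqrt_le_one.2 ht.2)
    have h4 : √t ^ 4 = t ^ 2 := by
      rw [show √t ^ 4 = (√t ^ 2) ^ 2 by ring, Real.sq_sqrt ht.1.le]
    rw [Real.sq_sqrt ht.1.le] at hc
    rw [hc, Function.comp_apply, h4]
    have := ht.1.ne'
    field_simp
    ring

end

/-- The difference of the expansions, divided by `s²`, tends to zero; multiplying by `s` isolates
the first coefficients, and then the second ones remain. -/
theorem HasLowSNRExpansion.unique {C : ℝ → ℝ} {c₁ c₂ d₁ d₂ : ℝ}
    (h : HasLowSNRExpansion C c₁ c₂) (h' : HasLowSNRExpansion C d₁ d₂) : c₁ = d₁ ∧ c₂ = d₂ := by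
  have hpos : ∀ᶠ s : ℝ in 𝓝[>] 0, 0 < s := self_mem_nhdsWithin
  have hid : Tendsto (fun s : ℝ => s) (𝓝[>] 0) (𝓝 0) := nhdsWithin_le_nhds
  have hdiv := (h'.sub h).tendsto_div_nhds_zero
  have hlim : Tendsto (fun s : ℝ => (c₁ - d₁) / s + (c₂ - d₂)) (𝓝[>] 0) (𝓝 0) := by
    refine hdiv.congr' ?_
    filter_upwards [hpos] with s hs
    field_simp
    ring
  have h1 : c₁ = d₁ := by
    have h2 : Tendsto (fun s : ℝ => (c₁ - d₁) + (c₂ - d₂) * s) (𝓝[>] 0) (𝓝 0) := by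
      have := hlim.mul hid
      rw [zero_mul] at this
      refine this.congr' ?_
      filter_upwards [hpos] with s hs
      field_simp
    have h3 : Tendsto (fun s : ℝ => (c₁ - d₁) + (c₂ - d₂) * s) (𝓝[>] 0) (𝓝 (c₁ - d₁)) := by
      simpa using (hid.const_mul (c₂ - d₂)).const_add (c₁ - d₁)
    linarith [tendsto_nhds_unique h2 h3]
  refine ⟨h1, ?_⟩
  subst h1
  simp only [sub_self, zero_div, zero_add] at hlim
  linarith [tendsto_nhds_unique hlim tendsto_const_nhds]

/-! ### PSK rings and their mixtures -/

theorem psk_point_eq (M : ℕ) (r θ : ℝ) (k : ℕ) :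
    (r : ℂ) * Complex.exp (((θ + 2 * Real.pi * k / M : ℝ) : ℂ) * Complex.I) =
      (r : ℂ) * Complex.exp (θ * Complex.I) * Complex.exp (2 * Real.pi * Complex.I / M) ^ k := by
  rw [← Complex.exp_nat_mul, mul_assoc (r : ℂ), ← Complex.exp_add]
  congr 2
  push_cast
  ring

theorem psk_point_injOn {M : ℕ} {r : ℝ} (hM : M ≠ 0) (hr : 0 < r) (θ : ℝ) :
    Set.InjOn (fun k : ℕ =>
      (r : ℂ) * Complex.exp (((θ + 2 * Real.pi * k / M : ℝ) : ℂ) * Complex.I))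
      (Finset.range M : Set ℕ) := by
  intro j hj k hk h
  simp only [psk_point_eq] at h
  have hne : (r : ℂ) * Complex.exp (θ * Complex.I) ≠ 0 :=
    mul_ne_zero (by exact_mod_cast hr.ne') (Complex.exp_ne_zero _)
  exact (Complex.isPrimitiveRoot_exp M hM).pow_inj (by simpa using hj) (by simpa using hk)
    (mul_left_cancel₀ hne h)

theorem card_pskRing {M : ℕ} {r : ℝ} (hM : M ≠ 0) (hr : 0 < r) (θ : ℝ) :
    (pskRing M r θ).card = M := by
  rw [pskRing, Finset.card_image_of_injOn (psk_point_injOn hM hr θ), Finset.card_range]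

theorem sum_pow_pskRing {M : ℕ} {r : ℝ} (hM : M ≠ 0) (hr : 0 < r) (θ : ℝ) (j : ℕ) :
    ∑ x ∈ pskRing M r θ, x ^ j = ((r : ℂ) * Complex.exp (θ * Complex.I)) ^ j *
      ∑ k ∈ Finset.range M, (Complex.exp (2 * Real.pi * Complex.I / M) ^ j) ^ k := by
  rw [pskRing, Finset.sum_image (psk_point_injOn hM hr θ), Finset.mul_sum]
  refine Finset.sum_congr rfl fun k _ => ?_
  rw [psk_point_eq, mul_pow, ← pow_mul, ← pow_mul, mul_comm k j]

/-- The geometric sum has ratio `ζ^j ≠ 1` with `(ζ^j)^M = 1`. The case `j = 1` gives zero mean, and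
`j = 2` kills the pseudo-variance of every ring with `M > 2`. -/
theorem sum_pow_pskRing_eq_zero {M : ℕ} {r : ℝ} (hr : 0 < r) (θ : ℝ) {j : ℕ} (hj : 0 < j)
    (hjM : j < M) : ∑ x ∈ pskRing M r θ, x ^ j = 0 := by
  have hM : M ≠ 0 := by omega
  have hp := Complex.isPrimitiveRoot_exp M hM
  have hne : Complex.exp (2 * Real.pi * Complex.I / M) ^ j ≠ 1 :=
    hp.pow_ne_one_of_pos_of_lt hj.ne' hjM
  rw [sum_pow_pskRing hM hr, geom_sum_eq hne, ← pow_mul, mul_comm j, pow_mul, hp.pow_eq_one,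
    one_pow, sub_self, zero_div, mul_zero]

theorem sum_sq_pskRing_two {r : ℝ} (hr : 0 < r) (θ : ℝ) :
    ∑ x ∈ pskRing 2 r θ, x ^ 2 = 2 * (r : ℂ) ^ 2 * Complex.exp (2 * θ * Complex.I) := by
  have hp := (Complex.isPrimitiveRoot_exp 2 two_ne_zero).pow_eq_one
  rw [sum_pow_pskRing two_ne_zero hr, hp, mul_pow, ← Complex.exp_nat_mul]
  simp only [one_pow, Finset.sum_const, Finset.card_range]
  push_cast
  rw [← mul_assoc, nsmul_eq_mul]
  push_cast
  ring

theorem uniformProb_nonneg (A : Finset ℂ) (x : ℂ) : 0 ≤ uniformProb A x := by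
  unfold uniformProb; split_ifs <;> positivity

theorem mixtureProb_nonneg {N : ℕ} {w : Fin N → ℝ} (hw : ∀ n, 0 ≤ w n) (A : Fin N → Finset ℂ)
    (x : ℂ) : 0 ≤ mixtureProb w A x :=
  Finset.sum_nonneg fun n _ => mul_nonneg (hw n) (uniformProb_nonneg _ _)

/-- Overlapping rings need no separate treatment: a shared point collects mass from each ring, and
exchanging the sums separates the rings again. -/
theorem sum_mixtureProb_mul {N : ℕ} (w : Fin N → ℝ) (A : Fin N → Finset ℂ) (f : ℂ → ℂ) :
    ∑ x ∈ mixtureSet A, (mixtureProb w A x : ℂ) * f x =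
      ∑ n, (w n : ℂ) / (A n).card * ∑ x ∈ A n, f x := by
  simp only [mixtureProb, Complex.ofReal_sum, Finset.sum_mul]
  rw [Finset.sum_comm]
  refine Finset.sum_congr rfl fun n _ => ?_
  have hsub : A n ⊆ mixtureSet A := Finset.subset_biUnion_of_mem A (Finset.mem_univ n)
  rw [Finset.mul_sum, ← Finset.sum_subset hsub]
  · refine Finset.sum_congr rfl fun x hx => ?_
    rw [uniformProb, if_pos hx]
    push_cast
    ring
  · intro x _ hx
    simp [uniformProb, hx]

theorem sum_mixtureProb {N : ℕ} {w : Fin N → ℝ} (hw1 : ∑ n, w n = 1) {A : Fin N → Finset ℂ}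
    (hA : ∀ n, (A n).Nonempty) : ∑ x ∈ mixtureSet A, mixtureProb w A x = 1 := by
  have h := sum_mixtureProb_mul w A fun _ => 1
  have h2 : ∀ n, (w n : ℂ) / (A n).card * ∑ _x ∈ A n, (1 : ℂ) = w n := fun n => by
    have : ((A n).card : ℂ) ≠ 0 := by exact_mod_cast (hA n).card_pos.ne'
    rw [Finset.sum_const, nsmul_eq_mul, mul_one, div_mul_cancel₀ _ this]
  simp only [h2, mul_one] at h
  rw [← Complex.ofReal_sum, ← Complex.ofReal_sum, hw1] at h
  exact_mod_cast h

/-- If the binary rings of a mixture of PSK rings are collinear, then the mixture is proper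
if and only if it has no binary ring. -/
theorem pskMixture_pseudoVariance_eq_zero_iff {N : ℕ} {M : Fin N → ℕ} {w r θ : Fin N → ℝ}
    (hM : ∀ n, 2 ≤ M n) (hw : ∀ n, 0 < w n) (hr : ∀ n, 0 < r n)
    (hθ : ∀ i j, M i = 2 → M j = 2 → ∃ k : ℤ, θ i - θ j = k * Real.pi) :
    ∑ x ∈ mixtureSet fun n => pskRing (M n) (r n) (θ n),
      (mixtureProb w (fun n => pskRing (M n) (r n) (θ n)) x : ℂ) * x ^ 2 = 0 ↔
      ∀ n, 2 < M n := by
  rw [sum_mixtureProb_mul w _ fun x => x ^ 2]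
  constructor
  · intro h
    by_contra! hex
    obtain ⟨j, hj⟩ := hex
    have hj2 : M j = 2 := le_antisymm hj (hM j)
    -- Doubling an offset difference in `πℤ` gives a multiple of `2π`, so all binary rings carry the
    -- phase of ring `j`, with positive real coefficients.
    have hterm : ∀ n, (w n : ℂ) / (pskRing (M n) (r n) (θ n)).card *
        ∑ x ∈ pskRing (M n) (r n) (θ n), x ^ 2 =
        ((if M n = 2 then w n * r n ^ 2 else 0 : ℝ) : ℂ) *
          Complex.exp (2 * θ j * Complex.I) := by
      intro n
      rw [card_pskRing (by have := hM n; omega) (hr n)]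
      split_ifs with hn
      · obtain ⟨k, hk⟩ := hθ n j hn hj2
        have hexp : Complex.exp (2 * θ n * Complex.I) = Complex.exp (2 * θ j * Complex.I) := by
          refine Complex.exp_eq_exp_iff_exists_int.2 ⟨k, ?_⟩
          have : (θ n : ℂ) = θ j + k * Real.pi := by
            have : θ n = θ j + k * Real.pi := by linarith
            exact_mod_cast this
          rw [this]; ring
        rw [hn, sum_sq_pskRing_two (hr n), hexp]
        push_cast
        ring
      · rw [sum_pow_pskRing_eq_zero (hr n) _ two_pos (lt_of_le_of_ne (hM n) (Ne.symm hn))]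
        simp
    simp only [hterm] at h
    rw [← Finset.sum_mul, ← Complex.ofReal_sum] at h
    have h0 : ∑ n, (if M n = 2 then w n * r n ^ 2 else 0) = 0 := by
      exact_mod_cast (mul_eq_zero.1 h).resolve_right (Complex.exp_ne_zero _)
    have hpos : 0 < ∑ n, (if M n = 2 then w n * r n ^ 2 else 0) := by
      refine Finset.sum_pos' (fun n _ => ?_) ⟨j, Finset.mem_univ j, ?_⟩
      · split_ifs
        · exact mul_nonneg (hw n).le (sq_nonneg _)
        · exact le_rfl
      · rw [if_pos hj2]
        exact mul_pos (hw j) (pow_pos (hr j) 2)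
    exact hpos.ne' h0
  · intro h
    refine Finset.sum_eq_zero fun n _ => ?_
    rw [sum_pow_pskRing_eq_zero (hr n) _ two_pos (h n), mul_zero]

theorem corollary2 (N : ℕ) (M : Fin N → ℕ) (w r θ : Fin N → ℝ)
    (hM : ∀ n, 2 ≤ M n)
    (hw : ∀ n, 0 < w n) (hw1 : ∑ n, w n = 1)
    (hr : ∀ n, 0 < r n)
    (hθ : ∀ i j, M i = 2 → M j = 2 → ∃ k : ℤ, θ i - θ j = k * Real.pi)
    (hE : secondMoment (mixtureSet fun n => pskRing (M n) (r n) (θ n))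
      (mixtureProb w fun n => pskRing (M n) (r n) (θ n)) = 1) :
    (∃ c₁ c₂ : ℝ, HasLowSNRExpansion
      (constrainedCapacity (mixtureSet fun n => pskRing (M n) (r n) (θ n))
        (mixtureProb w fun n => pskRing (M n) (r n) (θ n))) c₁ c₂) ∧
    ∀ c₁ c₂ : ℝ, HasLowSNRExpansion
      (constrainedCapacity (mixtureSet fun n => pskRing (M n) (r n) (θ n))
        (mixtureProb w fun n => pskRing (M n) (r n) (θ n))) c₁ c₂ →
      (c₂ = -1 / 2 ↔ ∀ n, 2 < M n) := by
  have hM0 : ∀ n, M n ≠ 0 := fun n => by have := hM n; omega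
  have hne : ∀ n, (pskRing (M n) (r n) (θ n)).Nonempty := fun n =>
    Finset.card_pos.1 (by rw [card_pskRing (hM0 n) (hr n)]; exact Nat.pos_of_ne_zero (hM0 n))
  have hmean : ∑ x ∈ mixtureSet fun n => pskRing (M n) (r n) (θ n),
      (mixtureProb w (fun n => pskRing (M n) (r n) (θ n)) x : ℂ) * x = 0 := by
    rw [sum_mixtureProb_mul w _ fun x => x]
    refine Finset.sum_eq_zero fun n _ => ?_
    have := sum_pow_pskRing_eq_zero (hr n) (θ n) one_pos (lt_of_lt_of_le one_lt_two (hM n))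
    simp only [pow_one] at this
    rw [this, mul_zero]
  have hexp := hasLowSNRExpansion_constrainedCapacity
    (fun x _ => mixtureProb_nonneg (fun n => (hw n).le) _ x) (sum_mixtureProb hw1 hne) hmean
  refine ⟨⟨_, _, hexp⟩, fun c₁ c₂ h => ?_⟩
  rw [(h.unique hexp).2, hE, ← pskMixture_pseudoVariance_eq_zero_iff hM hw hr hθ,
    ← norm_eq_zero, ← sq_eq_zero_iff]
  constructor <;> intro h' <;> linarith
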